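/- Let $d\ge 0$ be an integer, $c>0$, and let $\mathcal A=L^2(\mathbb R^d)\cap L^\infty(\mathbb R^d)$ (complex functions, Lebesgue measure), with pointwise product, involution $f\mapsto\bar f$ and scalar product $\langle f,g\rangle=\int\bar f g$. Let $\Gamma_2(\mathcal A)$ be the quadratic Fock space: the Hilbert space completion of the cyclic Fock representation, with unit vacuum vector $\Phi$, of the $*$-Lie algebra with generators $B^+_f,B_f,N_f$ ($f\in\mathcal A$; $B^+_f$ and $N_f$ linear, $B_f$ antilinear in $f$), involution $(B^+_f)^*=B_f$, $N_f^*=N_{\bar f}$, and commutation relations $[B_f,B^+_g]=2c\langle f,g\rangle+4N_{\bar fg}$, $[N_a,B^+_f]=2B^+_{af}$, $[B^+_f,B^+_g]=[B_f,B_g]=[N_a,N_{a'}]=0$, the vacuum satisfying $B_f\Phi=N_f\Phi=0$ for all $f\in\mathcal A$. For $f\in\mathcal A$ the quadratic exponential vector is $\Psi(f)=\sum_{n\ge0}\frac1{n!}(B^+_f)^n\Phi$ whenever this series converges. For a linear operator $T$ on $\mathcal A$, the quadratic second quantization $\Gamma_2(T)$ is the linear operator on the span of all quadratic exponential vectors with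 $\Gamma_2(T)\Psi(f)=\Psi(Tf)$, provided that $\Psi(Tf)$ exists whenever $\Psi(f)$ does and that such a linear operator exists. A $*$-endomorphism of $\mathcal A$ is a linear map $T_1:\mathcal A\to\mathcal A$ with $T_1(fg)=T_1(f)T_1(g)$, $T_1(\bar f)=\overline{T_1(f)}$ and $\langle T_1f,T_1g\rangle=\langle f,g\rangle$; it is a $*$-automorphism if it is moreover surjective. Let $\alpha:\mathbb R^d\to\mathbb R$ be a Borel function, $T_1$ a $*$-endomorphism of $\mathcal A$, and $T=e^{i\alpha}T_1$, i.e. $(Tf)(x)=e^{i\alpha(x)}(T_1f)(x)$. Then $\Gamma_2(T)$ exists, is densely defined, and is an isometry, i.e. it extends to a linear isometry of $\Gamma_2(\mathcal A)$ into itself. If, moreover, $T_1$ is a $*$-automorphism of $\mathcal A$, then $\Gamma_2(T)$ is unitary, i.e. it extends to a unitary operator of $\Gamma_2(\mathcal A)$ onto itself. -/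

import Mathlib

open MeasureTheory ENNReal
open scoped ComplexOrder ComplexConjugate

/-- The square integrable, essentially bounded complex functions on `ℝ^d` (Lebesgue measure),
up to equality almost everywhere, as a linear subspace of all measurable functions. -/
def testSubmodule (d : ℕ) : Submodule ℂ (EuclideanSpace ℝ (Fin d) →ₘ[volume] ℂ) where
  carrier := {f | MemLp f 2 volume ∧ MemLp f ∞ volume}
  add_mem' {f g} hf hg :=
    ⟨(memLp_congr_ae (AEEqFun.coeFn_add f g)).2 (hf.1.add hg.1),
      (memLp_congr_ae (AEEqFun.coeFn_add f g)).2 (hf.2.add hg.2)⟩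
  zero_mem' :=
    ⟨(memLp_congr_ae AEEqFun.coeFn_zero).2 MemLp.zero,
      (memLp_congr_ae AEEqFun.coeFn_zero).2 MemLp.zero⟩
  smul_mem' a f hf :=
    ⟨(memLp_congr_ae (AEEqFun.coeFn_smul a f)).2 (hf.1.const_smul a),
      (memLp_congr_ae (AEEqFun.coeFn_smul a f)).2 (hf.2.const_smul a)⟩

/-- The test function algebra `L²(ℝ^d) ∩ L^∞(ℝ^d)`. -/
abbrev TestFn (d : ℕ) : Type := testSubmodule d

namespace TestFn

variable {d : ℕ}

noncomputable instance : CoeFun (TestFn d) (fun _ => EuclideanSpace ℝ (Fin d) → ℂ) := ⟨fun f => f.1⟩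

theorem ext_ae {f g : TestFn d} (h : ⇑f =ᵐ[volume] ⇑g) : f = g := Subtype.ext (AEEqFun.ext h)

theorem memLp_two (f : TestFn d) : MemLp f 2 volume := f.2.1
theorem memLp_top (f : TestFn d) : MemLp f ∞ volume := f.2.2

theorem coe_add (f g : TestFn d) : ⇑(f + g) =ᵐ[volume] fun x => f x + g x := AEEqFun.coeFn_add f.1 g.1
theorem coe_smul (a : ℂ) (f : TestFn d) : ⇑(a • f) =ᵐ[volume] fun x => a * f x :=
  AEEqFun.coeFn_smul a f.1

/-- The class of a function that is both square integrable and essentially bounded. -/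
noncomputable def ofMemLp (f : EuclideanSpace ℝ (Fin d) → ℂ) (h2 : MemLp f 2 volume)
    (hi : MemLp f ∞ volume) : TestFn d :=
  ⟨AEEqFun.mk f h2.1, (memLp_congr_ae (AEEqFun.coeFn_mk f h2.1)).2 h2,
    (memLp_congr_ae (AEEqFun.coeFn_mk f h2.1)).2 hi⟩

theorem coe_ofMemLp (f : EuclideanSpace ℝ (Fin d) → ℂ) (h2 : MemLp f 2 volume)
    (hi : MemLp f ∞ volume) : ⇑(ofMemLp f h2 hi) =ᵐ[volume] f := AEEqFun.coeFn_mk f h2.1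

/-- Pointwise product. -/
noncomputable instance : Mul (TestFn d) :=
  ⟨fun f g => ofMemLp (fun x => f x * g x) (g.memLp_two.mul f.memLp_top)
    (g.memLp_top.mul f.memLp_top)⟩

/-- Pointwise complex conjugation. -/
noncomputable instance : Star (TestFn d) :=
  ⟨fun f => ofMemLp (fun x => star (f x)) f.memLp_two.star f.memLp_top.star⟩

theorem coe_mul (f g : TestFn d) : ⇑(f * g) =ᵐ[volume] fun x => f x * g x := coe_ofMemLp _ _ _
theorem coe_star (f : TestFn d) : ⇑(star f) =ᵐ[volume] fun x => star (f x) := coe_ofMemLp _ _ _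

noncomputable instance : NonUnitalCommRing (TestFn d) :=
  { (inferInstance : AddCommGroup (TestFn d)), (inferInstance : Mul (TestFn d)) with
    left_distrib := fun f g h => ext_ae <| by
      filter_upwards [coe_mul f (g + h), coe_add g h, coe_add (f * g) (f * h), coe_mul f g,
        coe_mul f h] with x h1 h2 h3 h4 h5
      rw [h1, h2, h3, h4, h5, mul_add]
    right_distrib := fun f g h => ext_ae <| by
      filter_upwards [coe_mul (f + g) h, coe_add f g, coe_add (f * h) (g * h), coe_mul f h,
        coe_mul g h] with x h1 h2 h3 h4 h5
      rw [h1, h2, h3, h4, h5, add_mul]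
    zero_mul := fun f => ext_ae <| by
      have h0 : ⇑(0 : TestFn d) =ᵐ[volume] 0 := AEEqFun.coeFn_zero
      filter_upwards [coe_mul 0 f, h0] with x h1 h2
      rw [h1, h2, Pi.zero_apply, zero_mul]
    mul_zero := fun f => ext_ae <| by
      have h0 : ⇑(0 : TestFn d) =ᵐ[volume] 0 := AEEqFun.coeFn_zero
      filter_upwards [coe_mul f 0, h0] with x h1 h2
      rw [h1, h2, Pi.zero_apply, mul_zero]
    mul_assoc := fun f g h => ext_ae <| by
      filter_upwards [coe_mul (f * g) h, coe_mul f g, coe_mul f (g * h), coe_mul g h]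
        with x h1 h2 h3 h4
      rw [h1, h2, h3, h4, mul_assoc]
    mul_comm := fun f g => ext_ae <| by
      filter_upwards [coe_mul f g, coe_mul g f] with x h1 h2
      rw [h1, h2, mul_comm] }

noncomputable instance : StarRing (TestFn d) where
  star_involutive f := ext_ae <| by
    filter_upwards [coe_star (star f), coe_star f] with x h1 h2
    rw [h1, h2, star_star]
  star_mul f g := ext_ae <| by
    filter_upwards [coe_star (f * g), coe_mul f g, coe_mul (star g) (star f), coe_star f,
      coe_star g] with x h1 h2 h3 h4 h5
    rw [h1, h2, h3, h4, h5, star_mul]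
  star_add f g := ext_ae <| by
    filter_upwards [coe_star (f + g), coe_add f g, coe_add (star f) (star g), coe_star f,
      coe_star g] with x h1 h2 h3 h4 h5
    rw [h1, h2, h3, h4, h5, star_add]

instance : IsScalarTower ℂ (TestFn d) (TestFn d) where
  smul_assoc a f g := ext_ae <| by
    change ⇑((a • f) * g) =ᵐ[volume] ⇑(a • (f * g))
    filter_upwards [coe_mul (a • f) g, coe_smul a f, coe_smul a (f * g), coe_mul f g]
      with x h1 h2 h3 h4
    rw [h1, h2, h3, h4, mul_assoc]

instance : SMulCommClass ℂ (TestFn d) (TestFn d) where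
  smul_comm a f g := ext_ae <| by
    change ⇑(a • (f * g)) =ᵐ[volume] ⇑(f * (a • g))
    filter_upwards [coe_mul f (a • g), coe_smul a g, coe_smul a (f * g), coe_mul f g]
      with x h1 h2 h3 h4
    rw [h1, h2, h3, h4, mul_left_comm]

instance : StarModule ℂ (TestFn d) where
  star_smul a f := ext_ae <| by
    filter_upwards [coe_star (a • f), coe_smul a f, coe_smul (star a) (star f), coe_star f]
      with x h1 h2 h3 h4
    rw [h1, h2, h3, h4, star_mul']

theorem integrable_star_mul (f g : TestFn d) :
    Integrable (fun x => star (f x) * g x) volume :=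
  f.memLp_two.star.integrable_mul g.memLp_two

/-- The scalar product `⟨f, g⟩ = ∫ conj (f x) g x dx`. -/
noncomputable def ip : TestFn d →ₗ⋆[ℂ] TestFn d →ₗ[ℂ] ℂ :=
  LinearMap.mk₂'ₛₗ (starRingEnd ℂ) (RingHom.id ℂ) (fun f g => ∫ x, star (f x) * g x)
    (fun f f' g => by
      rw [← integral_add (integrable_star_mul f g) (integrable_star_mul f' g)]
      refine integral_congr_ae ?_
      filter_upwards [coe_add f f'] with x h
      rw [h, star_add, add_mul])
    (fun a f g => by
      rw [smul_eq_mul, ← integral_const_mul]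
      refine integral_congr_ae ?_
      filter_upwards [coe_smul a f] with x h
      rw [h, star_mul', mul_assoc]; rfl)
    (fun f g g' => by
      rw [← integral_add (integrable_star_mul f g) (integrable_star_mul f g')]
      refine integral_congr_ae ?_
      filter_upwards [coe_add g g'] with x h
      rw [h, mul_add])
    (fun a f g => by
      rw [smul_eq_mul, RingHom.id_apply, ← integral_const_mul]
      refine integral_congr_ae ?_
      filter_upwards [coe_smul a g] with x h
      rw [h, mul_left_comm])

theorem ip_apply (f g : TestFn d) : ip f g = ∫ x, star (f x) * g x := rfl

theorem ip_star (f g : TestFn d) : star (ip f g) = ip g f := by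
  rw [ip_apply, ip_apply]
  change (starRingEnd ℂ) _ = _
  rw [← integral_conj]
  refine integral_congr_ae (Filter.Eventually.of_forall fun x => ?_)
  simp [mul_comm]

theorem ip_mul (a f g : TestFn d) : ip (a * f) g = ip f (star a * g) := by
  rw [ip_apply, ip_apply]
  refine integral_congr_ae ?_
  filter_upwards [coe_mul a f, coe_mul (star a) g, coe_star a] with x h1 h2 h3
  rw [h1, h2, h3, star_mul']; ring

theorem ip_self_nonneg (f : TestFn d) : 0 ≤ ip f f := by
  have : ip f f = ((∫ x, ‖f x‖ ^ 2 : ℝ) : ℂ) := by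
    rw [ip_apply]
    refine Eq.trans ?_ integral_ofReal
    refine integral_congr_ae (Filter.Eventually.of_forall fun x => ?_)
    simp [Complex.conj_mul']
  rw [this]
  exact_mod_cast integral_nonneg fun x => by positivity

theorem memLp_phase (α : EuclideanSpace ℝ (Fin d) → ℝ) (hα : Measurable α) (p : ℝ≥0∞)
    {f : EuclideanSpace ℝ (Fin d) → ℂ} (hf : MemLp f p volume) :
    MemLp (fun x => Complex.exp (Complex.I * α x) * f x) p volume :=
  hf.of_le ((by fun_prop :
      Measurable fun x => Complex.exp (Complex.I * α x)).aestronglyMeasurable.mul hf.1)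
    (Filter.Eventually.of_forall fun x => by
      simp [mul_comm Complex.I, Complex.norm_exp_ofReal_mul_I])

/-- The function `x ↦ e^{iα(x)} f(x)`. -/
noncomputable def phaseMul (α : EuclideanSpace ℝ (Fin d) → ℝ) (hα : Measurable α) (f : TestFn d) :
    TestFn d :=
  ofMemLp (fun x => Complex.exp (Complex.I * α x) * f x) (memLp_phase α hα 2 f.memLp_two)
    (memLp_phase α hα ∞ f.memLp_top)

theorem coe_phaseMul (α : EuclideanSpace ℝ (Fin d) → ℝ) (hα : Measurable α) (f : TestFn d) :
    ⇑(phaseMul α hα f) =ᵐ[volume] fun x => Complex.exp (Complex.I * α x) * f x :=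
  coe_ofMemLp _ _ _

/-- Multiplication by the phase factor `e^{iα}`. -/
noncomputable def phase (α : EuclideanSpace ℝ (Fin d) → ℝ) (hα : Measurable α) :
    TestFn d →ₗ[ℂ] TestFn d where
  toFun := phaseMul α hα
  map_add' f g := ext_ae <| by
    filter_upwards [coe_add f g, coe_add (phaseMul α hα f) (phaseMul α hα g),
      coe_phaseMul α hα (f + g), coe_phaseMul α hα f, coe_phaseMul α hα g] with x h1 h2 h3 h4 h5
    rw [h3, h1, h2, h4, h5, mul_add]
  map_smul' a f := ext_ae <| by
    filter_upwards [coe_smul a f, coe_smul a (phaseMul α hα f), coe_phaseMul α hα (a • f),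
      coe_phaseMul α hα f] with x h1 h2 h3 h4
    rw [h3, h1, RingHom.id_apply, h2, h4, mul_left_comm]

end TestFn

/-- The linear span of the vectors `B⁺_{f₁} ⋯ B⁺_{fₙ} Φ`: since the `B⁺_f` commute and depend linearly
on `f`, it is the symmetric algebra over the test functions. -/
abbrev FockPoly (d : ℕ) : Type := SymmetricAlgebra ℂ (TestFn d)

namespace FockPoly

variable {d : ℕ}

/-- The universal property of the symmetric algebra for commuting families of operators. -/
noncomputable def liftEnd {V W : Type*} [AddCommGroup V] [Module ℂ V] [AddCommGroup W] [Module ℂ W]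
    (φ : V →ₗ[ℂ] Module.End ℂ W) (h : ∀ f g, φ f * φ g = φ g * φ f) :
    SymmetricAlgebra ℂ V →ₐ[ℂ] Module.End ℂ W :=
  RingCon.liftₐ (TensorAlgebra.symRingCon ℂ V) (TensorAlgebra.lift ℂ φ) <|
    RingCon.ringConGen_le.2 fun x y hxy => by
      induction hxy with
      | mul_comm x y => rw [RingCon.ker_apply]; simp [h x y]

theorem liftEnd_ι {V W : Type*} [AddCommGroup V] [Module ℂ V] [AddCommGroup W] [Module ℂ W]
    (φ : V →ₗ[ℂ] Module.End ℂ W) (h : ∀ f g, φ f * φ g = φ g * φ f) (f : V) :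
    liftEnd φ h (SymmetricAlgebra.ι ℂ V f) = φ f :=
  (RingCon.liftₐ_mk (TensorAlgebra.symRingCon ℂ V) (TensorAlgebra.lift ℂ φ) _
    (TensorAlgebra.ι ℂ f)).trans (TensorAlgebra.lift_ι_apply φ f)

/-- The one-particle vector `B⁺_f Φ`. -/
noncomputable abbrev gen : TestFn d →ₗ[ℂ] FockPoly d := SymmetricAlgebra.ι ℂ (TestFn d)

@[elab_as_elim]
theorem induction_left {P : FockPoly d → Prop} (one : P 1) (add : ∀ x y, P x → P y → P (x + y))
    (smul : ∀ (a : ℂ) x, P x → P (a • x)) (cons : ∀ f x, P x → P (gen f * x)) (x : FockPoly d) :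
    P x := by
  suffices H : ∀ x y : FockPoly d, P y → P (x * y) by simpa using H x 1 one
  intro x
  refine SymmetricAlgebra.induction ℂ (TestFn d)
    (motive := fun x => ∀ y : FockPoly d, P y → P (x * y)) ?_ ?_ ?_ ?_ x
  · intro r y hy; rw [← Algebra.smul_def]; exact smul r y hy
  · intro f; exact cons f
  · intro a b ha hb y hy; rw [mul_assoc]; exact ha _ (hb _ hy)
  · intro a b ha hb y hy; rw [add_mul]; exact add _ _ (ha _ hy) (hb _ hy)

/-- The creation operator `B⁺_f`. -/
noncomputable def Bp (f : TestFn d) : Module.End ℂ (FockPoly d) := LinearMap.mulLeft ℂ (gen f)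

theorem Bp_apply (f : TestFn d) (x : FockPoly d) : Bp f x = gen f * x := rfl

/-- The algebra map with values in the dual numbers whose second component is `N_a`. -/
noncomputable def numHom (a : TestFn d) : FockPoly d →ₐ[ℂ] TrivSqZeroExt (FockPoly d) (FockPoly d) :=
  SymmetricAlgebra.lift
    ((TrivSqZeroExt.inlAlgHom ℂ (FockPoly d) (FockPoly d)).toLinearMap ∘ₗ gen +
      (TrivSqZeroExt.inrHom (FockPoly d) (FockPoly d)).restrictScalars ℂ ∘ₗ
        ((2 : ℂ) • (gen ∘ₗ LinearMap.mulLeft ℂ a)))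

/-- The number operator `N_a`: the derivation with `N_a B⁺_f Φ = 2 B⁺_{af} Φ`. -/
noncomputable def N (a : TestFn d) : Module.End ℂ (FockPoly d) :=
  (TrivSqZeroExt.sndHom (FockPoly d) (FockPoly d)).restrictScalars ℂ ∘ₗ (numHom a).toLinearMap

theorem numHom_fst (a : TestFn d) (x : FockPoly d) : (numHom a x).fst = x := by
  have : (TrivSqZeroExt.fstHom ℂ (FockPoly d) (FockPoly d)).comp (numHom a) = AlgHom.id ℂ _ := by
    apply SymmetricAlgebra.algHom_ext
    ext f
    simp [numHom]
  exact congrArg (fun φ => φ x) this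

theorem N_one (a : TestFn d) : N a 1 = 0 := by simp [N]

theorem N_gen_mul (a f : TestFn d) (x : FockPoly d) :
    N a (gen f * x) = gen f * N a x + (2 : ℂ) • (gen (a * f) * x) := by
  have h : numHom a (gen f) = TrivSqZeroExt.inl (gen f) + TrivSqZeroExt.inr ((2 : ℂ) • gen (a * f)) := by
    simp [numHom]
  have h1 := numHom_fst a x
  simp only [N, LinearMap.comp_apply, AlgHom.toLinearMap_apply, map_mul, LinearMap.restrictScalars_apply,
    TrivSqZeroExt.sndHom_apply, TrivSqZeroExt.snd_mul, h, h1]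
  simp [mul_comm]

theorem N_add (a b : TestFn d) (x : FockPoly d) : N (a + b) x = N a x + N b x := by
  induction x using induction_left with
  | one => simp [N_one]
  | add x y hx hy => simp only [map_add, hx, hy]; abel
  | smul r x hx => simp only [map_smul, hx, smul_add]
  | cons f x hx => simp only [N_gen_mul, hx, add_mul, map_add, mul_add, smul_add]; abel

theorem N_smul (r : ℂ) (a : TestFn d) (x : FockPoly d) : N (r • a) x = r • N a x := by
  induction x using induction_left with
  | one => simp [N_one]
  | add x y hx hy => simp only [map_add, hx, hy, smul_add]
  | smul s x hx => simp only [map_smul, hx, smul_comm r s]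
  | cons f x hx =>
    simp only [N_gen_mul, hx, smul_mul_assoc, map_smul, mul_smul_comm, smul_add, smul_comm r (2 : ℂ)]

/-- The effect of `B⁺_f` on the pair `(x, B_g x)`, as dictated by
`B_g B⁺_f = B⁺_f B_g + 2c ⟨g, f⟩ + 4 N_{conj g · f}`. -/
noncomputable def annStep (c : ℝ) (g : TestFn d) :
    TestFn d →ₗ[ℂ] Module.End ℂ (FockPoly d × FockPoly d) :=
  LinearMap.mk₂ ℂ
    (fun f w => (gen f * w.1,
      gen f * w.2 + (2 * c * TestFn.ip g f) • w.1 + (4 : ℂ) • N (star g * f) w.1))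
    (fun f f' w => by
      ext1
      · simp [add_mul]
      · simp only [map_add, add_mul, mul_add, N_add, Prod.snd_add]; module)
    (fun a f w => by
      ext1
      · simp
      · simp only [map_smul, smul_mul_assoc, mul_smul_comm, N_smul, Prod.smul_snd, smul_eq_mul]; module)
    (fun f w w' => by
      ext1
      · simp [mul_add]
      · simp only [map_add, mul_add, Prod.snd_add, Prod.fst_add]; module)
    (fun a f w => by
      ext1
      · simp
      · simp only [map_smul, mul_smul_comm, Prod.smul_snd, Prod.smul_fst]; module)

theorem annStep_comm (c : ℝ) (g f f' : TestFn d) :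
    annStep c g f * annStep c g f' = annStep c g f' * annStep c g f := by
  refine LinearMap.ext fun w => ?_
  ext1
  · simp only [annStep, Module.End.mul_apply, LinearMap.mk₂_apply]; ring
  · simp only [annStep, Module.End.mul_apply, LinearMap.mk₂_apply, N_gen_mul, mul_add, mul_smul_comm,
      mul_left_comm (gen f) (gen f')]
    rw [mul_right_comm (star g) f f']
    module

theorem annStep_apply (c : ℝ) (g f : TestFn d) (w : FockPoly d × FockPoly d) :
    annStep c g f w = (gen f * w.1,
      gen f * w.2 + (2 * c * TestFn.ip g f) • w.1 + (4 : ℂ) • N (star g * f) w.1) := rfl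

/-- The annihilation operator `B_g`, determined by `B_g Φ = 0` and the commutation relation
`[B_g, B⁺_f] = 2c ⟨g, f⟩ + 4 N_{conj g · f}`. -/
noncomputable def B (c : ℝ) (g : TestFn d) : Module.End ℂ (FockPoly d) :=
  LinearMap.snd ℂ (FockPoly d) (FockPoly d) ∘ₗ
    (LinearMap.applyₗ ((1, 0) : FockPoly d × FockPoly d)) ∘ₗ
      (liftEnd (annStep c g) (annStep_comm c g)).toLinearMap

theorem liftEnd_annStep_fst (c : ℝ) (g : TestFn d) (x : FockPoly d) :
    (liftEnd (annStep c g) (annStep_comm c g) x (1, 0)).1 = x := by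
  induction x using induction_left with
  | one => simp
  | add x y hx hy => simp [hx, hy]
  | smul s x hx => simp [hx]
  | cons f x hx =>
    rw [map_mul, Module.End.mul_apply, liftEnd_ι, annStep_apply, hx]

theorem B_one (c : ℝ) (g : TestFn d) : B c g 1 = 0 := by simp [B]

theorem B_gen_mul (c : ℝ) (g f : TestFn d) (x : FockPoly d) :
    B c g (gen f * x) =
      gen f * B c g x + (2 * c * TestFn.ip g f) • x + (4 : ℂ) • N (star g * f) x := by
  have h := liftEnd_annStep_fst c g x
  simp only [B, LinearMap.comp_apply, AlgHom.toLinearMap_apply, LinearMap.applyₗ_apply_apply, map_mul,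
    Module.End.mul_apply, liftEnd_ι, LinearMap.snd_apply, annStep_apply, h]

theorem B_add (c : ℝ) (g h : TestFn d) (x : FockPoly d) : B c (g + h) x = B c g x + B c h x := by
  induction x using induction_left with
  | one => simp [B_one]
  | add x y hx hy => simp only [map_add, hx, hy]; abel
  | smul r x hx => simp only [map_smul, hx, smul_add]
  | cons f x hx =>
    simp only [B_gen_mul, hx, star_add, add_mul, map_add, mul_add, N_add, LinearMap.add_apply]; module

theorem B_smul (c : ℝ) (r : ℂ) (g : TestFn d) (x : FockPoly d) :
    B c (r • g) x = star r • B c g x := by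
  induction x using induction_left with
  | one => simp [B_one]
  | add x y hx hy => simp only [map_add, hx, hy, smul_add]
  | smul s x hx => simp only [map_smul, hx, smul_comm s (star r)]
  | cons f x hx =>
    simp only [B_gen_mul, hx, star_smul, smul_mul_assoc, mul_smul_comm, N_smul, LinearMap.map_smulₛₗ,
      LinearMap.smul_apply, smul_eq_mul, starRingEnd_apply]
    module

theorem N_comm (a b : TestFn d) (x : FockPoly d) : N a (N b x) = N b (N a x) := by
  induction x using induction_left with
  | one => simp [N_one]
  | add x y hx hy => simp only [map_add, hx, hy]
  | smul r x hx => simp only [map_smul, hx]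
  | cons f x hx =>
    simp only [N_gen_mul, hx, map_add, map_smul, mul_left_comm a b f]; module

theorem B_N (c : ℝ) (a f : TestFn d) (x : FockPoly d) :
    B c f (N a x) = N a (B c f x) + (2 : ℂ) • B c (star a * f) x := by
  induction x using induction_left with
  | one => simp [N_one, B_one]
  | add x y hx hy => simp only [map_add, hx, hy]; module
  | smul r x hx => simp only [map_smul, hx]; module
  | cons g x hx =>
    have e : star (star a * f) * g = star f * (a * g) := by
      rw [star_mul, star_star, mul_assoc]
    simp only [N_gen_mul, B_gen_mul, hx, map_add, map_smul, N_comm a, e, TestFn.ip_mul, star_star,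
      mul_add, mul_smul_comm]
    module

theorem B_comm (c : ℝ) (f g : TestFn d) (x : FockPoly d) : B c f (B c g x) = B c g (B c f x) := by
  induction x using induction_left with
  | one => simp [B_one]
  | add x y hx hy => simp only [map_add, hx, hy]
  | smul r x hx => simp only [map_smul, hx]
  | cons h x hx =>
    have e1 : star (star g * h) * f = star (star f * h) * g := by
      simp only [star_mul, star_star, mul_assoc, mul_comm f g]
    simp only [B_gen_mul, map_add, map_smul, B_N, hx, e1]
    module

end FockPoly

namespace FockPoly

variable {d : ℕ}

/-- The effect on the antilinear functional `⟨·, x⟩` of replacing `x` by `B⁺_f x`. -/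
noncomputable def pairStep (c : ℝ) : TestFn d →ₗ[ℂ] Module.End ℂ (FockPoly d →ₗ⋆[ℂ] ℂ) :=
  LinearMap.mk₂ ℂ (fun f φ => φ.comp (B c f))
    (fun f f' φ => by ext y; simp [B_add])
    (fun a f φ => by ext y; simp [B_smul])
    (fun f φ φ' => by ext y; simp)
    (fun a f φ => by ext y; simp)

theorem pairStep_apply (c : ℝ) (f : TestFn d) (φ : FockPoly d →ₗ⋆[ℂ] ℂ) (y : FockPoly d) :
    pairStep c f φ y = φ (B c f y) := rfl

theorem pairStep_comm (c : ℝ) (f g : TestFn d) :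
    pairStep c f * pairStep c g = pairStep c g * pairStep c f := by
  ext φ y
  simp only [Module.End.mul_apply, pairStep_apply, B_comm c f g]

/-- The coefficient of the vacuum `Φ`. -/
noncomputable def vacCoeff : FockPoly d →ₐ[ℂ] ℂ := SymmetricAlgebra.algebraMapInv

/-- The antilinear functional `y ↦ ⟨y, Φ⟩`. -/
noncomputable def vacPair : FockPoly d →ₗ⋆[ℂ] ℂ :=
  { toFun := fun y => star (vacCoeff y)
    map_add' := fun x y => by simp
    map_smul' := fun a x => by simp }

/-- The action of polynomials on antilinear functionals generated by `pairStep`. -/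
noncomputable def pairHom (c : ℝ) : FockPoly d →ₐ[ℂ] Module.End ℂ (FockPoly d →ₗ⋆[ℂ] ℂ) :=
  liftEnd (pairStep c) (pairStep_comm c)

/-- The scalar product: `⟨y, B⁺_{f₁} ⋯ B⁺_{fₙ} Φ⟩` is the complex conjugate of the vacuum coefficient of
`B_{fₙ} ⋯ B_{f₁} y`. -/
noncomputable def pair (c : ℝ) (y x : FockPoly d) : ℂ :=
  pairHom c x vacPair y

theorem vacCoeff_gen_mul (f : TestFn d) (x : FockPoly d) : vacCoeff (gen f * x) = 0 := by
  rw [map_mul, vacCoeff, SymmetricAlgebra.algebraMapInv_ι, zero_mul]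

theorem pair_one (c : ℝ) (y : FockPoly d) : pair c y 1 = star (vacCoeff y) := by
  simp [pair, vacPair]

theorem pair_gen_mul (c : ℝ) (f : TestFn d) (y x : FockPoly d) :
    pair c y (gen f * x) = pair c (B c f y) x := by
  simp only [pair, pairHom, map_mul, Module.End.mul_apply, liftEnd_ι, pairStep_apply]

theorem pair_add_right (c : ℝ) (y x x' : FockPoly d) : pair c y (x + x') = pair c y x + pair c y x' := by
  simp [pair]

theorem pair_smul_right (c : ℝ) (a : ℂ) (y x : FockPoly d) : pair c y (a • x) = a * pair c y x := by
  simp [pair]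

theorem pair_add_left (c : ℝ) (y y' x : FockPoly d) : pair c (y + y') x = pair c y x + pair c y' x := by
  simp [pair]

theorem pair_smul_left (c : ℝ) (a : ℂ) (y x : FockPoly d) : pair c (a • y) x = star a * pair c y x := by
  simp [pair]

theorem vacCoeff_N (a : TestFn d) (x : FockPoly d) : vacCoeff (N a x) = 0 := by
  induction x using induction_left with
  | one => simp [N_one]
  | add x y hx hy => simp only [map_add, hx, hy, add_zero]
  | smul r x hx => simp only [map_smul, hx, smul_zero]
  | cons f x hx => simp only [N_gen_mul, map_add, map_smul, vacCoeff_gen_mul, smul_zero, add_zero]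

theorem pair_N (c : ℝ) (a : TestFn d) (y x : FockPoly d) :
    pair c (N a y) x = pair c y (N (star a) x) := by
  induction x using induction_left generalizing y with
  | one => rw [pair_one, vacCoeff_N, N_one, ← zero_smul ℂ (1 : FockPoly d), pair_smul_right]; simp
  | add x x' hx hx' => simp only [map_add, pair_add_right, hx, hx']
  | smul r x hx => simp only [map_smul, pair_smul_right, hx]
  | cons f x hx =>
    simp only [N_gen_mul, pair_gen_mul, pair_add_right, pair_smul_right, B_N, pair_add_left,
      pair_smul_left, hx]
    simp

theorem pair_Bp (c : ℝ) (f : TestFn d) (y x : FockPoly d) :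
    pair c (gen f * y) x = pair c y (B c f x) := by
  induction x using induction_left generalizing y with
  | one => rw [pair_one, vacCoeff_gen_mul, B_one, ← zero_smul ℂ (1 : FockPoly d), pair_smul_right]; simp
  | add x x' hx hx' => simp only [map_add, pair_add_right, hx, hx']
  | smul r x hx => simp only [map_smul, pair_smul_right, hx]
  | cons g x hx =>
    have e : star (2 * c * TestFn.ip g f) = 2 * c * TestFn.ip f g := by
      rw [star_mul', TestFn.ip_star]; simp
    simp only [B_gen_mul, pair_gen_mul, pair_add_right, pair_smul_right, pair_add_left,
      pair_smul_left, hx, pair_N, star_mul, star_star, e]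
    simp

theorem pair_one_left (c : ℝ) (x : FockPoly d) : pair c 1 x = vacCoeff x := by
  induction x using induction_left with
  | one => simp [pair_one]
  | add x x' hx hx' => simp only [map_add, pair_add_right, hx, hx']
  | smul r x hx => simp only [map_smul, pair_smul_right, hx, smul_eq_mul]
  | cons g x hx =>
    rw [pair_gen_mul, B_one, vacCoeff_gen_mul, ← zero_smul ℂ (1 : FockPoly d), pair_smul_left]; simp

theorem star_pair (c : ℝ) (y x : FockPoly d) : star (pair c y x) = pair c x y := by
  induction x using induction_left generalizing y with
  | one => rw [pair_one, star_star, pair_one_left]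
  | add x x' hx hx' => rw [pair_add_right, star_add, hx, hx', pair_add_left]
  | smul r x hx => rw [pair_smul_right, star_mul', hx, pair_smul_left]
  | cons g x hx => rw [pair_gen_mul, hx, pair_Bp]

/-! Positivity of the scalar product. -/

theorem N_pow (a g : TestFn d) (n : ℕ) :
    N a (gen g ^ (n + 1)) = (2 * (n + 1) : ℂ) • (gen (a * g) * gen g ^ n) := by
  induction n with
  | zero =>
    rw [zero_add, pow_one, pow_zero, ← mul_one (gen g), N_gen_mul, N_one]
    simp
  | succ n ih =>
    rw [pow_succ' _ (n + 1), N_gen_mul, ih, mul_smul_comm, mul_left_comm, ← pow_succ']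
    push_cast
    module

theorem B_gen (c : ℝ) (h g : TestFn d) :
    B c h (gen g ^ 1) = (2 * c * TestFn.ip h g) • (1 : FockPoly d) := by
  rw [pow_one, ← mul_one (gen g), B_gen_mul, B_one, N_one]
  simp

theorem B_pow (c : ℝ) (h g : TestFn d) (n : ℕ) :
    B c h (gen g ^ (n + 2)) = (2 * c * (n + 2) * TestFn.ip h g) • gen g ^ (n + 1) +
      (4 * (n + 2) * (n + 1) : ℂ) • (gen (star h * (g * g)) * gen g ^ n) := by
  induction n with
  | zero =>
    rw [zero_add, pow_succ' (gen g) 1, B_gen_mul, B_gen, N_pow (star h * g) g 0, mul_assoc (star h)]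
    simp only [mul_smul_comm, mul_one, zero_add, pow_one, pow_zero, Nat.cast_zero]
    module
  | succ n ih =>
    rw [pow_succ' (gen g) (n + 2), B_gen_mul, ih, N_pow, mul_assoc (star h)]
    simp only [mul_add, mul_smul_comm]
    rw [← pow_succ', mul_left_comm, ← pow_succ']
    push_cast
    module

/-- The power `f ^ (k + 1)`. -/
noncomputable def pw (f : TestFn d) : ℕ → TestFn d
  | 0 => f
  | k + 1 => pw f k * f

/-- The function `f ^ (k + 1) * conj g ^ k`. -/
noncomputable def mixed : ℕ → TestFn d → TestFn d → TestFn d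
  | 0, f, _ => f
  | k + 1, f, g => star (mixed k g f) * (f * f)

theorem mixed_succ (k : ℕ) (f g : TestFn d) : mixed (k + 1) f g = star (pw g k) * pw f (k + 1) := by
  induction k generalizing f g with
  | zero => rfl
  | succ k ih =>
    rw [mixed, ih, star_mul, star_star, mul_assoc, mul_left_comm (pw f k),  mul_comm (star _)]
    simp only [pw]
    ac_rfl

theorem ip_mixed (k : ℕ) (f g : TestFn d) :
    TestFn.ip (mixed k f g) g = TestFn.ip (pw f k) (pw g k) := by
  cases k with
  | zero => rfl
  | succ k => rw [mixed_succ, TestFn.ip_mul, star_star]; rfl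

theorem posSemidef_ip : (Matrix.of fun f g : TestFn d => TestFn.ip f g).PosSemidef := by
  refine ⟨?_, fun x => ?_⟩
  · ext f g
    simpa using TestFn.ip_star g f
  · have := TestFn.ip_self_nonneg (x.sum fun f a => a • f)
    convert this using 1
    simp only [Finsupp.sum, map_sum, LinearMap.sum_apply, map_smul, LinearMap.map_smulₛₗ,
      LinearMap.smul_apply, smul_eq_mul, Matrix.of_apply]
    simp only [starRingEnd_apply, Finset.mul_sum]
    rw [Finset.sum_comm]
    refine Finset.sum_congr rfl fun i _ => Finset.sum_congr rfl fun j _ => ?_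
    ring

theorem posSemidef_ip_pw (k : ℕ) :
    (Matrix.of fun f g : TestFn d => TestFn.ip (pw f k) (pw g k)).PosSemidef :=
  posSemidef_ip.submatrix fun f => pw f k

theorem posSemidef_one {α : Type*} : (Matrix.of fun _ _ : α => (1 : ℂ)).PosSemidef := by
  refine ⟨by ext; simp, fun x => ?_⟩
  have := star_mul_self_nonneg (x.sum fun _ a => a)
  convert this using 1
  simp only [Finsupp.sum, star_sum, Finset.sum_mul_sum, Matrix.of_apply, mul_one]

theorem posSemidef_aux {c : ℝ} (hc : 0 ≤ c) (n : ℕ) : ∀ k : ℕ,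
    (Matrix.of fun f g : TestFn d =>
      pair c (gen (mixed k f g) * gen f ^ n) (gen g ^ (n + 1))).PosSemidef ∧
    (Matrix.of fun f g : TestFn d =>
      pair c (gen f ^ (n + 1)) (gen (mixed k g f) * gen g ^ n)).PosSemidef := by
  have e : ∀ (n : ℕ), (2 * c * (n + 2) : ℂ) = ((2 * c * (n + 2) : ℝ) : ℂ) := fun n => by push_cast; rfl
  have ip' : ∀ (k : ℕ) (f g : TestFn d),
      star (TestFn.ip (mixed k g f) f) = TestFn.ip (pw f k) (pw g k) := fun k f g => by
    rw [ip_mixed, TestFn.ip_star]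
  induction n with
  | zero =>
    intro k
    have h1 : (Matrix.of fun f g : TestFn d => (2 * c : ℂ) * TestFn.ip (pw f k) (pw g k)).PosSemidef :=
      (posSemidef_ip_pw k).smul (a := (2 * c : ℂ)) (by exact_mod_cast mul_nonneg two_pos.le hc)
    refine ⟨?_, ?_⟩
    · convert h1 using 4 with f g
      rw [pair_Bp, B_gen, pow_zero, pair_smul_right, ip_mixed, pair_one]; simp
    · convert h1 using 4 with f g
      rw [pair_gen_mul, B_gen, pow_zero, pair_smul_left, pair_one, star_mul', ip']; simp
  | succ n ih =>
    intro k
    have h0 : (Matrix.of fun f g : TestFn d =>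
        pair c (gen f ^ (n + 1)) (gen g ^ (n + 1))).PosSemidef := by
      convert (ih 0).1 using 4 with f g
      rw [pow_succ' (gen f)]; rfl
    have h1 := ((posSemidef_ip_pw k).hadamard h0).smul (a := (2 * c * (n + 2) : ℂ))
      (by rw [e]; exact_mod_cast by positivity)
    have e4 : (0 : ℂ) ≤ 4 * (n + 2) * (n + 1) := by
      have : (4 * (n + 2) * (n + 1) : ℂ) = ((4 * (n + 2) * (n + 1) : ℝ) : ℂ) := by push_cast; rfl
      rw [this]; exact_mod_cast by positivity
    refine ⟨?_, ?_⟩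
    · refine (congrArg Matrix.PosSemidef ?_).mpr (h1.add ((ih (k + 1)).2.smul e4))
      ext f g
      rw [Matrix.of_apply, pair_Bp, B_pow, pair_add_right, pair_smul_right, pair_smul_right, ip_mixed]
      simp [mixed, Matrix.hadamard]
      ring
    · refine (congrArg Matrix.PosSemidef ?_).mpr (h1.add ((ih (k + 1)).1.smul e4))
      ext f g
      rw [Matrix.of_apply, pair_gen_mul, B_pow, pair_add_left, pair_smul_left, pair_smul_left,
        star_mul', ip']
      simp [mixed, Matrix.hadamard]
      ring

theorem posSemidef_pow {c : ℝ} (hc : 0 ≤ c) (n : ℕ) :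
    (Matrix.of fun f g : TestFn d => pair c (gen f ^ n) (gen g ^ n)).PosSemidef := by
  cases n with
  | zero => simpa [pair_one] using posSemidef_one
  | succ n =>
    convert (posSemidef_aux hc n 0).1 using 4 with f g
    rw [pow_succ' (gen f)]; rfl

/-- Doubling of the test functions. -/
noncomputable def dil : FockPoly d →ₐ[ℂ] FockPoly d := SymmetricAlgebra.lift ((2 : ℂ) • gen)

theorem dil_gen (f : TestFn d) : dil (gen f) = (2 : ℂ) • gen f := by simp [dil]

theorem dil_N (a : TestFn d) (x : FockPoly d) : N a (dil x) = dil (N a x) := by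
  induction x using induction_left with
  | one => simp [N_one]
  | add x y hx hy => simp only [map_add, hx, hy]
  | smul r x hx => simp only [map_smul, hx]
  | cons f x hx =>
    simp only [N_gen_mul, map_mul, dil_gen, map_add, map_smul, smul_mul_assoc, hx]; module

theorem B_dil (c : ℝ) (g : TestFn d) (x : FockPoly d) :
    B c g (dil x) = (2 : ℂ) • dil (B c g x) := by
  induction x using induction_left with
  | one => simp [B_one]
  | add x y hx hy => simp only [map_add, hx, hy, smul_add]
  | smul r x hx => simp only [map_smul, hx, smul_comm r (2 : ℂ)]
  | cons f x hx =>
    simp only [B_gen_mul, map_mul, dil_gen, map_add, map_smul, smul_mul_assoc, hx, dil_N,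
      mul_smul_comm]

theorem pair_dil (c : ℝ) (y x : FockPoly d) : pair c (dil y) x = pair c y (dil x) := by
  induction x using induction_left generalizing y with
  | one =>
    have : vacCoeff.comp dil = (vacCoeff : FockPoly d →ₐ[ℂ] ℂ) := by
      apply SymmetricAlgebra.algHom_ext
      ext f
      simp [dil, vacCoeff, SymmetricAlgebra.algebraMapInv]
    have h := congrArg (fun φ : FockPoly d →ₐ[ℂ] ℂ => φ y) this
    simp only [AlgHom.comp_apply] at h
    rw [map_one, pair_one, pair_one, h]
  | add x x' hx hx' => simp only [map_add, pair_add_right, hx, hx']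
  | smul r x hx => simp only [map_smul, pair_smul_right, hx]
  | cons g x hx =>
    rw [pair_gen_mul, B_dil, map_mul, dil_gen, smul_mul_assoc, pair_smul_right, pair_smul_left, hx,
      pair_gen_mul]
    simp

theorem pair_pow_of_ne (c : ℝ) (f g : TestFn d) {n m : ℕ} (h : n ≠ m) :
    pair c (gen f ^ n) (gen g ^ m) = 0 := by
  have := pair_dil c (gen f ^ n) (gen g ^ m)
  simp only [map_pow, dil_gen, smul_pow, pair_smul_left, pair_smul_right] at this
  by_contra h0
  have h2 := mul_right_cancel₀ h0 this
  have h3 : (2 : ℕ) ^ n = 2 ^ m := by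
    have : ((2 ^ n : ℕ) : ℂ) = ((2 ^ m : ℕ) : ℂ) := by push_cast; simpa using h2
    exact_mod_cast this
  exact h (Nat.pow_right_injective le_rfl h3)

theorem span_pow :
    Submodule.span ℂ (Set.range fun i : TestFn d × ℕ => gen i.1 ^ i.2) = ⊤ := by
  set P := Submodule.span ℂ (Set.range fun i : TestFn d × ℕ => gen i.1 ^ i.2) with hP
  have hmem : ∀ (f : TestFn d) (n : ℕ), gen f ^ n ∈ P := fun f n => Submodule.subset_span ⟨(f, n), rfl⟩
  have key : ∀ (g f : TestFn d) (n : ℕ), gen g * gen f ^ n ∈ P := by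
    intro g f n
    by_contra hx
    obtain ⟨ψ, hψ, hle⟩ := Submodule.exists_le_ker_of_notMem hx
    let q : Polynomial ℂ := ∑ k ∈ Finset.range (n + 2),
      Polynomial.monomial k (ψ (gen g ^ k * gen f ^ (n + 1 - k) * ((n + 1).choose k : FockPoly d)))
    have hq : q = 0 := by
      refine Polynomial.funext fun t => ?_
      have h0 : ψ (gen (t • g + f) ^ (n + 1)) = 0 := hle (hmem _ _)
      rw [map_add, map_smul, add_pow, map_sum] at h0
      rw [Polynomial.eval_zero, ← h0, Polynomial.eval_finsetSum]
      refine Finset.sum_congr rfl fun k _ => ?_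
      rw [Polynomial.eval_monomial, smul_pow, smul_mul_assoc, smul_mul_assoc, map_smul, smul_eq_mul,
        mul_comm]
    have h1 := congrArg (fun p => Polynomial.coeff p 1) hq
    simp only [q, Polynomial.finsetSum_coeff, Polynomial.coeff_monomial, Polynomial.coeff_zero] at h1
    rw [Finset.sum_ite_eq' , if_pos (by simp)] at h1
    rw [Nat.choose_one_right, pow_one, Nat.add_sub_cancel, mul_comm, ← nsmul_eq_mul, map_nsmul] at h1
    exact hψ ((smul_eq_zero.1 h1).resolve_left (Nat.succ_ne_zero n))
  rw [eq_top_iff]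
  intro x _
  induction x using induction_left with
  | one => simpa using hmem 0 0
  | add x y hx hy => exact P.add_mem (hx trivial) (hy trivial)
  | smul r x hx => exact P.smul_mem r (hx trivial)
  | cons f x hx =>
    have h : P ≤ P.comap (LinearMap.mulLeft ℂ (gen f)) := by
      rw [hP, Submodule.span_le]
      rintro _ ⟨i, rfl⟩
      exact key f i.1 i.2
    exact h (hx trivial)

theorem pair_self_nonneg {c : ℝ} (hc : 0 ≤ c) (x : FockPoly d) : 0 ≤ pair c x x := by
  classical
  have hx : x ∈ Submodule.span ℂ (Set.range fun i : TestFn d × ℕ => gen i.1 ^ i.2) := by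
    rw [span_pow]; trivial
  obtain ⟨v, rfl⟩ := Finsupp.mem_span_range_iff_exists_finsupp.1 hx
  have pl : ∀ (s : Finset (TestFn d × ℕ)) (F : TestFn d × ℕ → FockPoly d) (z : FockPoly d),
      pair c (∑ i ∈ s, F i) z = ∑ i ∈ s, pair c (F i) z := fun s F z => by
    simp [pair]
  have pr : ∀ (s : Finset (TestFn d × ℕ)) (F : TestFn d × ℕ → FockPoly d) (z : FockPoly d),
      pair c z (∑ i ∈ s, F i) = ∑ i ∈ s, pair c z (F i) := fun s F z => by
    simp [pair]
  have main : pair c (v.sum fun i a => a • gen i.1 ^ i.2) (v.sum fun i a => a • gen i.1 ^ i.2) =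
      ∑ n ∈ v.support.image Prod.snd, ((v.filter fun i => i.2 = n).sum fun i a =>
        (v.filter fun i => i.2 = n).sum fun j b =>
          star a * pair c (gen i.1 ^ n) (gen j.1 ^ n) * b) := by
    simp only [Finsupp.sum, Finsupp.support_filter, Finset.sum_filter, pl, pr, pair_smul_left,
      pair_smul_right]
    refine Eq.trans ?_ Finset.sum_comm
    refine Finset.sum_congr rfl fun i hi => ?_
    rw [Finset.sum_eq_single_of_mem i.2 (Finset.mem_image_of_mem _ hi)]
    · rw [if_pos rfl]
      refine Finset.sum_congr rfl fun j hj => ?_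
      split_ifs with h
      · rw [Finsupp.filter_apply, Finsupp.filter_apply, if_pos rfl, if_pos h, h]; ring
      · rw [pair_pow_of_ne c _ _ (Ne.symm h)]; simp
    · intro n _ hn
      rw [if_neg (Ne.symm hn)]
  rw [main]
  refine Finset.sum_nonneg fun n _ => ?_
  have h := ((posSemidef_pow hc n).submatrix (Prod.fst : TestFn d × ℕ → TestFn d)).2
    (v.filter fun i => i.2 = n)
  exact h

end FockPoly

/-- A (cyclic) Fock representation of the algebra of the renormalized square of white noise with
parameter `c`, on a pre-Hilbert space `D`: operators `B⁺_f`, `B_f`, `N_f` (`f` a test function) on `D`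
which represent the commutation relations and the involution of the algebra, together with a
cyclic unit vector `Φ` that is killed by all `B_f` and `N_f`.  By the GNS theorem these are the
GNS representations of the quadratic Fock state. -/
structure IsQuadraticFockRepresentation {d : ℕ} (c : ℝ) {D : Type*} [SeminormedAddCommGroup D]
    [InnerProductSpace ℂ D] (Bp B N : TestFn d → Module.End ℂ D) (Φ : D) : Prop where
  Bp_add : ∀ f g, Bp (f + g) = Bp f + Bp g
  Bp_smul : ∀ (a : ℂ) f, Bp (a • f) = a • Bp f
  B_add : ∀ f g, B (f + g) = B f + B g
  B_smul : ∀ (a : ℂ) f, B (a • f) = star a • B f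
  N_add : ∀ f g, N (f + g) = N f + N g
  N_smul : ∀ (a : ℂ) f, N (a • f) = a • N f
  inner_Bp : ∀ f (x y : D), inner ℂ (Bp f x) y = inner ℂ x (B f y)
  inner_N : ∀ f (x y : D), inner ℂ (N f x) y = inner ℂ x (N (star f) y)
  B_Bp : ∀ f g, B f * Bp g - Bp g * B f = (2 * c * TestFn.ip f g) • 1 + (4 : ℂ) • N (star f * g)
  N_Bp : ∀ a f, N a * Bp f - Bp f * N a = (2 : ℂ) • Bp (a * f)
  Bp_Bp : ∀ f g, Bp f * Bp g = Bp g * Bp f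
  B_B : ∀ f g, B f * B g = B g * B f
  N_N : ∀ a b, N a * N b = N b * N a
  norm_vacuum : ‖Φ‖ = 1
  B_vacuum : ∀ f, B f Φ = 0
  N_vacuum : ∀ f, N f Φ = 0
  cyclic : ∀ S : Submodule ℂ D, Φ ∈ S →
    (∀ f, ∀ x ∈ S, Bp f x ∈ S ∧ B f x ∈ S ∧ N f x ∈ S) → S = ⊤

/-- The pre-Hilbert space spanned by the vectors `B⁺_{f₁} ⋯ B⁺_{fₙ} Φ`, with the (positive
semidefinite) scalar product determined by the commutation relations. -/
def PreFock (d : ℕ) (c : ℝ) (_ : 0 < c) : Type := FockPoly d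

namespace PreFock

variable {d : ℕ} {c : ℝ} (hc : 0 < c)

/-- The scalar product on `PreFock`. -/
@[reducible]
noncomputable def core : PreInnerProductSpace.Core ℂ (FockPoly d) where
  inner := FockPoly.pair c
  conj_inner_symm x y := FockPoly.star_pair c y x
  re_inner_nonneg x := (Complex.le_def.1 (FockPoly.pair_self_nonneg hc.le x)).1
  add_left := FockPoly.pair_add_left c
  smul_left x y r := FockPoly.pair_smul_left c r x y

noncomputable instance : SeminormedAddCommGroup (PreFock d c hc) :=
  @InnerProductSpace.Core.toSeminormedAddCommGroup ℂ (FockPoly d) _ _ _ (core hc)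

noncomputable instance : InnerProductSpace ℂ (PreFock d c hc) :=
  @InnerProductSpace.ofCore ℂ (FockPoly d) _ _ _ (core hc)

/-- The vacuum vector. -/
noncomputable def vac : PreFock d c hc := (1 : FockPoly d)

/-- The creation operator `B⁺_f`. -/
noncomputable def Bp (f : TestFn d) : Module.End ℂ (PreFock d c hc) := FockPoly.Bp f

/-- The annihilation operator `B_f`. -/
noncomputable def B (f : TestFn d) : Module.End ℂ (PreFock d c hc) := FockPoly.B c f

/-- The number operator `N_f`. -/
noncomputable def N (f : TestFn d) : Module.End ℂ (PreFock d c hc) := FockPoly.N f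

theorem isQuadraticFockRepresentation :
    IsQuadraticFockRepresentation c (Bp (d := d) hc) (B hc) (N hc) (vac hc) where
  Bp_add f g := LinearMap.ext <|
    show ∀ x : FockPoly d, FockPoly.gen (f + g) * x = FockPoly.gen f * x + FockPoly.gen g * x from
      fun x => by rw [map_add, add_mul]
  Bp_smul a f := LinearMap.ext <|
    show ∀ x : FockPoly d, FockPoly.gen (a • f) * x = a • (FockPoly.gen f * x) from
      fun x => by rw [map_smul, smul_mul_assoc]
  B_add f g := LinearMap.ext fun x => FockPoly.B_add c f g x
  B_smul a f := LinearMap.ext fun x => FockPoly.B_smul c a f x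
  N_add f g := LinearMap.ext fun x => FockPoly.N_add f g x
  N_smul a f := LinearMap.ext fun x => FockPoly.N_smul a f x
  inner_Bp f x y := FockPoly.pair_Bp c f x y
  inner_N f x y := FockPoly.pair_N c f x y
  B_Bp f g := LinearMap.ext <|
    show ∀ x : FockPoly d, FockPoly.B c f (FockPoly.gen g * x) - FockPoly.gen g * FockPoly.B c f x =
      (2 * c * TestFn.ip f g) • x + (4 : ℂ) • FockPoly.N (star f * g) x from
      fun x => by rw [FockPoly.B_gen_mul]; abel
  N_Bp a f := LinearMap.ext <|
    show ∀ x : FockPoly d, FockPoly.N a (FockPoly.gen f * x) - FockPoly.gen f * FockPoly.N a x =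
      (2 : ℂ) • (FockPoly.gen (a * f) * x) from
      fun x => by rw [FockPoly.N_gen_mul]; abel
  Bp_Bp f g := LinearMap.ext <|
    show ∀ x : FockPoly d, FockPoly.gen f * (FockPoly.gen g * x) =
      FockPoly.gen g * (FockPoly.gen f * x) from fun x => mul_left_comm _ _ _
  B_B f g := LinearMap.ext fun x => FockPoly.B_comm c f g x
  N_N a b := LinearMap.ext fun x => FockPoly.N_comm a b x
  norm_vacuum := by
    have h : inner ℂ (vac (d := d) hc) (vac hc) = 1 := by
      change FockPoly.pair c (1 : FockPoly d) 1 = 1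
      simp [FockPoly.pair_one]
    have h2 : ‖vac (d := d) hc‖ ^ 2 = 1 := by
      rw [← inner_self_eq_norm_sq (𝕜 := ℂ), h]; simp
    exact (pow_eq_one_iff_of_nonneg (norm_nonneg _) two_ne_zero).1 h2
  B_vacuum f := FockPoly.B_one c f
  N_vacuum f := FockPoly.N_one f
  cyclic S h1 h := by
    refine eq_top_iff.2 fun x _ => ?_
    exact FockPoly.induction_left (P := fun x => (x : PreFock d c hc) ∈ S) h1
      (fun _ _ => S.add_mem) (fun a _ => S.smul_mem a) (fun f x hx => (h f x hx).1) x

end PreFock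

/-- The quadratic Fock space over `L²(ℝ^d) ∩ L^∞(ℝ^d)`. -/
abbrev QuadraticFock (d : ℕ) (c : ℝ) (hc : 0 < c) : Type := UniformSpace.Completion (PreFock d c hc)

namespace QuadraticFock

variable {d : ℕ} {c : ℝ} (hc : 0 < c)

/-- The `n`-particle vector `(B⁺_f)ⁿ Φ`. -/
noncomputable def particle (f : TestFn d) (n : ℕ) : QuadraticFock d c hc :=
  ((PreFock.Bp hc f ^ n) (PreFock.vac hc) : PreFock d c hc)

/-- The quadratic exponential vector with test function `f` exists. -/
def ExpExists (f : TestFn d) : Prop :=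
  Summable fun n : ℕ => ((n.factorial : ℂ)⁻¹) • particle hc f n

/-- The quadratic exponential vector `Ψ(f) = ∑ (B⁺_f)ⁿ Φ / n!`. -/
noncomputable def expVec (f : TestFn d) : QuadraticFock d c hc :=
  ∑' n : ℕ, ((n.factorial : ℂ)⁻¹) • particle hc f n

/-- The linear span of the quadratic exponential vectors. -/
noncomputable def expSpan (d : ℕ) {c : ℝ} (hc : 0 < c) : Submodule ℂ (QuadraticFock d c hc) :=
  Submodule.span ℂ {x | ∃ f : TestFn d, ExpExists hc f ∧ expVec hc f = x}

theorem expVec_mem {f : TestFn d} (hf : ExpExists hc f) : expVec hc f ∈ expSpan d hc :=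
  Submodule.subset_span ⟨f, hf, rfl⟩

/-- `G` is the quadratic second quantization `Γ₂(T)`: the map `Ψ(f) ↦ Ψ(T f)` is defined on all
quadratic exponential vectors, and `G` is its (unique) linear extension to their span. -/
def IsSecondQuantization (T : TestFn d →ₗ[ℂ] TestFn d)
    (G : expSpan d hc →ₗ[ℂ] QuadraticFock d c hc) : Prop :=
  ∀ (f : TestFn d) (hf : ExpExists hc f),
    ExpExists hc (T f) ∧ G ⟨expVec hc f, expVec_mem hc hf⟩ = expVec hc (T f)

end QuadraticFock

/-- A `*`-endomorphism of the Hilbert algebra `L²(ℝ^d) ∩ L^∞(ℝ^d)`. -/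
structure IsStarEndomorphism {d : ℕ} (T : TestFn d →ₗ[ℂ] TestFn d) : Prop where
  isometry : ∀ f g, TestFn.ip (T f) (T g) = TestFn.ip f g
  map_mul : ∀ f g, T (f * g) = T f * T g
  map_star : ∀ f, T (star f) = star (T f)

/-- A `*`-automorphism: a `*`-endomorphism that is unitary, that is, also onto. -/
structure IsStarAutomorphism {d : ℕ} (T : TestFn d →ₗ[ℂ] TestFn d) : Prop
    extends IsStarEndomorphism T where
  surjective : Function.Surjective T

/-! The second quantization is built before completion. On the algebraic Fock space, the symmetric
algebra over the test functions, `T = e^{iα} T₁` induces the algebra endomorphism `FockPoly.map T`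
with `B⁺_{f₁} ⋯ B⁺_{fₙ} Φ ↦ B⁺_{T f₁} ⋯ B⁺_{T fₙ} Φ`. The scalar product is computed by moving
annihilators to the right, and in `[B_{T f}, B⁺_{T g}] = 2c ⟨T f, T g⟩ + 4 N_{conj (T f) · T g}` the
phase cancels: `⟨T f, T g⟩ = ⟨f, g⟩` and `conj (T f) · T g = T₁ (conj f · g)`. Since also
`T₁ a · T f = T (a f)`, the map intertwines `N_a` with `N_{T₁ a}` and `B_f` with `B_{T f}`, so it
preserves the scalar product (`FockPoly.pair_map`) and extends to an isometry `V` of the completion.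
As `V` is continuous and maps `(B⁺_f)ⁿ Φ` to `(B⁺_{T f})ⁿ Φ`, it maps a convergent series `Ψ(f)` to
`Ψ(T f)`; in particular no linear independence of exponential vectors is needed for the existence
of `Γ₂(T)`. If `T₁` is onto, so are `T` and `FockPoly.map T`; then the closed range of `V` contains
a dense subspace, and `V` is unitary.

For the density of the exponential vectors, a recursion gives `‖(B⁺_f)ⁿ Φ‖ ≤ n! Rⁿ`
(`FockPoly.norm_pair_mixed_le`, `QuadraticFock.exists_norm_particle_le`), so that `Ψ(t f)` exists for
small `t`. A vector orthogonal to all exponential vectors is then orthogonal to the Taylor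
coefficients `(B⁺_f)ⁿ Φ / n!` of `t ↦ Ψ(t f)`, and by polarization (`FockPoly.span_pow`) these span
the algebraic Fock space. -/

/-! ### Multiplication by a phase -/

namespace TestFn

variable {d : ℕ}

theorem coe_phase (α : EuclideanSpace ℝ (Fin d) → ℝ) (hα : Measurable α) (f : TestFn d) :
    ⇑(phase α hα f) =ᵐ[volume] fun x => Complex.exp (Complex.I * α x) * f x :=
  coe_phaseMul α hα f

theorem star_exp_mul_exp (t : ℝ) :
    star (Complex.exp (Complex.I * t)) * Complex.exp (Complex.I * t) = 1 := by
  change (starRingEnd ℂ) _ * _ = _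
  rw [← Complex.exp_conj, ← Complex.exp_add]
  simp

theorem star_phase_mul_phase (α : EuclideanSpace ℝ (Fin d) → ℝ) (hα : Measurable α)
    (f g : TestFn d) : star (phase α hα f) * phase α hα g = star f * g := ext_ae <| by
  filter_upwards [coe_mul (star (phase α hα f)) (phase α hα g), coe_star (phase α hα f),
    coe_phase α hα f, coe_phase α hα g, coe_mul (star f) g, coe_star f] with x h1 h2 h3 h4 h5 h6
  rw [h1, h2, h3, h4, h5, h6, star_mul', mul_mul_mul_comm, star_exp_mul_exp, one_mul]

theorem mul_phase (α : EuclideanSpace ℝ (Fin d) → ℝ) (hα : Measurable α) (a f : TestFn d) :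
    a * phase α hα f = phase α hα (a * f) := ext_ae <| by
  filter_upwards [coe_mul a (phase α hα f), coe_phase α hα f, coe_phase α hα (a * f),
    coe_mul a f] with x h1 h2 h3 h4
  rw [h1, h2, h3, h4, mul_left_comm]

theorem ip_phase (α : EuclideanSpace ℝ (Fin d) → ℝ) (hα : Measurable α) (f g : TestFn d) :
    ip (phase α hα f) (phase α hα g) = ip f g := by
  rw [ip_apply, ip_apply]
  refine integral_congr_ae ?_
  filter_upwards [coe_phase α hα f, coe_phase α hα g] with x h1 h2
  rw [h1, h2, star_mul', mul_mul_mul_comm, star_exp_mul_exp, one_mul]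

theorem phase_surjective (α : EuclideanSpace ℝ (Fin d) → ℝ) (hα : Measurable α) :
    Function.Surjective (phase α hα) := fun f => by
  refine ⟨phase (-α) hα.neg f, ext_ae ?_⟩
  filter_upwards [coe_phase α hα (phase (-α) hα.neg f), coe_phase (-α) hα.neg f] with x h1 h2
  rw [h1, h2, ← mul_assoc, ← Complex.exp_add]
  simp

theorem coe_pw_succ (f : TestFn d) (k : ℕ) :
    ⇑(FockPoly.pw f (k + 1)) =ᵐ[volume] fun x => FockPoly.pw f k x * f x :=
  coe_mul _ _

/-- `‖f ^ (k + 1)‖₂ ≤ ‖f‖_∞ ^ k ‖f‖₂`; only the existence of some bound `m` of `|f|` matters. -/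
theorem exists_norm_ip_pw_le (f : TestFn d) : ∃ m : ℝ, ∀ k : ℕ,
    ‖ip (FockPoly.pw f k) (FockPoly.pw f k)‖ ≤ (m ^ 2) ^ k * ‖ip f f‖ := by
  have hfin : eLpNormEssSup f volume ≠ ∞ := by
    simpa only [eLpNorm_exponent_top] using f.memLp_top.eLpNorm_ne_top
  have hm : ∀ᵐ x, ‖f x‖ ≤ (eLpNormEssSup f volume).toReal := by
    filter_upwards [ae_le_eLpNormEssSup (f := f) (μ := volume)] with x hx
    rw [← toReal_enorm]
    exact ENNReal.toReal_mono hfin hx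
  have hip : ∀ g : TestFn d, ‖ip g g‖ = ∫ x, ‖g x‖ ^ 2 := fun g => by
    have : ip g g = ((∫ x, ‖g x‖ ^ 2 : ℝ) : ℂ) := by
      rw [ip_apply]
      refine Eq.trans ?_ integral_ofReal
      exact integral_congr_ae (Filter.Eventually.of_forall fun x => by simp [Complex.conj_mul'])
    rw [this, Complex.norm_real, Real.norm_of_nonneg (integral_nonneg fun x => by positivity)]
  have hint : ∀ g : TestFn d, Integrable (fun x => ‖g x‖ ^ 2) volume := fun g =>
    g.memLp_two.integrable_norm_pow two_ne_zero
  refine ⟨(eLpNormEssSup f volume).toReal, fun k => ?_⟩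
  induction k with
  | zero => simp [FockPoly.pw]
  | succ k ih =>
    refine le_trans ?_ ((mul_le_mul_of_nonneg_left ih (sq_nonneg _)).trans_eq (by ring))
    rw [hip, hip, ← integral_const_mul]
    refine integral_mono_ae (hint _) ((hint _).const_mul _) ?_
    filter_upwards [hm, coe_pw_succ f k] with x h1 h2
    rw [h2, norm_mul, mul_pow, mul_comm]
    gcongr

end TestFn

/-! ### Second quantization on the algebraic Fock space -/

namespace FockPoly

variable {d : ℕ}

/-- The algebra endomorphism `B⁺_{f₁} ⋯ B⁺_{fₙ} Φ ↦ B⁺_{T f₁} ⋯ B⁺_{T fₙ} Φ` of the algebraic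
Fock space, that is, the second quantization of `T` before completion. -/
noncomputable def map (T : TestFn d →ₗ[ℂ] TestFn d) : FockPoly d →ₐ[ℂ] FockPoly d :=
  SymmetricAlgebra.lift (gen ∘ₗ T)

theorem map_gen (T : TestFn d →ₗ[ℂ] TestFn d) (f : TestFn d) : map T (gen f) = gen (T f) := by
  simp [map]

theorem map_surjective {T : TestFn d →ₗ[ℂ] TestFn d} (hT : Function.Surjective T) :
    Function.Surjective (map T) := fun x => by
  induction x using induction_left with
  | one => exact ⟨1, map_one _⟩
  | add x y hx hy =>
    obtain ⟨x, rfl⟩ := hx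
    obtain ⟨y, rfl⟩ := hy
    exact ⟨x + y, map_add _ _ _⟩
  | smul r x hx =>
    obtain ⟨x, rfl⟩ := hx
    exact ⟨r • x, map_smul _ _ _⟩
  | cons f x hx =>
    obtain ⟨x, rfl⟩ := hx
    obtain ⟨f, rfl⟩ := hT f
    exact ⟨gen f * x, by rw [map_mul, map_gen]⟩

theorem vacCoeff_map (T : TestFn d →ₗ[ℂ] TestFn d) (x : FockPoly d) :
    vacCoeff (map T x) = vacCoeff x := by
  induction x using induction_left with
  | one => simp
  | add x y hx hy => simp only [map_add, hx, hy]
  | smul r x hx => simp only [map_smul, hx]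
  | cons f x hx => rw [map_mul, map_gen, vacCoeff_gen_mul, vacCoeff_gen_mul]

/-- If `S a · T f = T (a f)`, the second quantization of `T` intertwines `N_a` and `N_{S a}`. -/
theorem N_map {S T : TestFn d →ₗ[ℂ] TestFn d} (hmul : ∀ a f, S a * T f = T (a * f))
    (a : TestFn d) (x : FockPoly d) : N (S a) (map T x) = map T (N a x) := by
  induction x using induction_left with
  | one => simp [N_one]
  | add x y hx hy => simp only [map_add, hx, hy]
  | smul r x hx => simp only [map_smul, hx]
  | cons f x hx => simp only [map_mul, map_gen, N_gen_mul, hx, hmul, map_add, map_smul]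

/-- The second quantization of `T` intertwines `B_f` and `B_{T f}`: the commutation relation of
`B_{T f}` with `B⁺_{T g}` involves `T` only through `⟨T f, T g⟩` and `conj (T f) · T g`. -/
theorem B_map (c : ℝ) {S T : TestFn d →ₗ[ℂ] TestFn d} (hmul : ∀ a f, S a * T f = T (a * f))
    (hstar : ∀ f g, star (T f) * T g = S (star f * g))
    (hip : ∀ f g, TestFn.ip (T f) (T g) = TestFn.ip f g) (f : TestFn d) (x : FockPoly d) :
    B c (T f) (map T x) = map T (B c f x) := by
  induction x using induction_left with
  | one => simp [B_one]
  | add x y hx hy => simp only [map_add, hx, hy]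
  | smul r x hx => simp only [map_smul, hx]
  | cons g x hx =>
    simp only [map_mul, map_gen, B_gen_mul, hx, hstar, hip, N_map hmul, map_add, map_smul]

theorem pair_map (c : ℝ) {S T : TestFn d →ₗ[ℂ] TestFn d} (hmul : ∀ a f, S a * T f = T (a * f))
    (hstar : ∀ f g, star (T f) * T g = S (star f * g))
    (hip : ∀ f g, TestFn.ip (T f) (T g) = TestFn.ip f g) (y x : FockPoly d) :
    pair c (map T y) (map T x) = pair c y x := by
  induction x using induction_left generalizing y with
  | one => rw [map_one, pair_one, pair_one, vacCoeff_map]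
  | add x x' hx hx' => simp only [map_add, pair_add_right, hx, hx']
  | smul r x hx => simp only [map_smul, pair_smul_right, hx]
  | cons f x hx =>
    rw [map_mul, map_gen, pair_gen_mul, B_map c hmul hstar hip, hx, pair_gen_mul]

/-! ### Growth of the `n`-particle norms -/

/-- The recursion `B_f (B⁺_f)^(n+2) Φ = 2c(n+2)‖f‖² (B⁺_f)^(n+1) Φ + 4(n+2)(n+1) B⁺_{f²f̄} (B⁺_f)^n Φ`
bounds the `n`-particle norms once all `f ^ (k + 1) conj f ^ k` are treated together; each step costs
a factor `(n + 2)²` times a constant. -/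
theorem norm_pair_mixed_le {c : ℝ} (hc : 0 ≤ c) (f : TestFn d) {m : ℝ}
    (hf : ∀ k : ℕ, ‖TestFn.ip (pw f k) (pw f k)‖ ≤ (m ^ 2) ^ k * ‖TestFn.ip f f‖) (n k : ℕ) :
    ‖pair c (gen (mixed k f f) * gen f ^ n) (gen f ^ (n + 1))‖ ≤
      2 * c * ‖TestFn.ip f f‖ * (m ^ 2) ^ k * (2 * c * ‖TestFn.ip f f‖ + 4 * m ^ 2) ^ n *
        ((n + 1).factorial : ℝ) ^ 2 := by
  induction n generalizing k with
  | zero =>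
    rw [pair_Bp, B_gen, pow_zero, pair_smul_right, ip_mixed, pair_one]
    have := mul_le_mul_of_nonneg_left (hf k) (by positivity : 0 ≤ 2 * c)
    simpa [abs_of_nonneg hc, mul_comm, mul_left_comm, mul_assoc] using this
  | succ n ih =>
    set L := ‖TestFn.ip f f‖
    set R := 2 * c * L + 4 * m ^ 2
    have hL : 0 ≤ L := norm_nonneg _
    have h0 : ‖pair c (gen f ^ (n + 1)) (gen f ^ (n + 1))‖ ≤
        2 * c * L * R ^ n * ((n + 1).factorial : ℝ) ^ 2 := by
      simpa [mixed, ← pow_succ'] using ih 0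
    have h1 : ‖pair c (gen f ^ (n + 1)) (gen (mixed (k + 1) f f) * gen f ^ n)‖ ≤
        2 * c * L * (m ^ 2) ^ (k + 1) * R ^ n * ((n + 1).factorial : ℝ) ^ 2 := by
      rw [← star_pair, norm_star]
      exact ih (k + 1)
    have e : star (mixed k f f) * (f * f) = mixed (k + 1) f f := rfl
    rw [pair_Bp, B_pow, pair_add_right, pair_smul_right, pair_smul_right, ip_mixed, e]
    have n1 : ‖(2 * c * ((n : ℂ) + 2))‖ = 2 * c * (n + 2) := by
      rw [show (2 * c * ((n : ℂ) + 2)) = ((2 * c * (n + 2) : ℝ) : ℂ) by push_cast; rfl,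
        Complex.norm_real, Real.norm_of_nonneg (by positivity)]
    have n2 : ‖(4 * ((n : ℂ) + 2) * (n + 1))‖ = 4 * (n + 2) * (n + 1) := by
      rw [show (4 * ((n : ℂ) + 2) * (n + 1)) = ((4 * (n + 2) * (n + 1) : ℝ) : ℂ) by push_cast; rfl,
        Complex.norm_real, Real.norm_of_nonneg (by positivity)]
    set Q := 2 * c * L * (m ^ 2) ^ k * R ^ n * ((n + 1).factorial : ℝ) ^ 2
    have hR : 0 ≤ R := by positivity
    have hQ : 0 ≤ Q := by positivity
    calc _ ≤ 2 * c * (n + 2) * ((m ^ 2) ^ k * L) *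
            (2 * c * L * R ^ n * ((n + 1).factorial : ℝ) ^ 2) + 4 * (n + 2) * (n + 1) *
            (2 * c * L * (m ^ 2) ^ (k + 1) * R ^ n * ((n + 1).factorial : ℝ) ^ 2) := by
          refine (norm_add_le _ _).trans ?_
          rw [norm_mul, norm_mul, n1, norm_mul, n2]
          gcongr
          exact hf k
      _ = (2 * c * L * (n + 2) + 4 * m ^ 2 * ((n + 2) * (n + 1))) * Q := by ring
      _ ≤ (2 * c * L * (n + 2) ^ 2 + 4 * m ^ 2 * (n + 2) ^ 2) * Q := by
          have hn : (0 : ℝ) ≤ n := n.cast_nonneg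
          gcongr <;> nlinarith
      _ = _ := by
          rw [Nat.factorial_succ (n + 1)]
          push_cast
          ring

end FockPoly

/-! ### Power series vanishing near the origin -/

/-- A scalar power series whose sum is `0` near the origin has zero coefficients. -/
theorem eq_zero_of_eventually_hasSum_zero {a : ℕ → ℂ}
    (h : ∀ᶠ z in nhds (0 : ℂ), HasSum (fun n => z ^ n * a n) 0) : a = 0 := by
  have hp : HasFPowerSeriesAt (fun _ => (0 : ℂ)) (FormalMultilinearSeries.ofScalars ℂ a) 0 := by
    rw [hasFPowerSeriesAt_iff]
    filter_upwards [h] with z hz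
    simpa using hz
  exact (FormalMultilinearSeries.ofScalars_series_eq_zero ℂ).1 hp.eq_zero

/-! ### Exponential vectors -/

namespace QuadraticFock

variable {d : ℕ} {c : ℝ} (hc : 0 < c)

/-- The canonical map from the algebraic Fock space to its completion. -/
noncomputable def toFock : FockPoly d →ₗ[ℂ] QuadraticFock d c hc :=
  (UniformSpace.Completion.toComplL (𝕜 := ℂ) (E := PreFock d c hc)).toLinearMap

theorem inner_toFock (x y : FockPoly d) :
    inner ℂ (toFock hc x) (toFock hc y) = FockPoly.pair c x y :=
  UniformSpace.Completion.inner_coe (𝕜 := ℂ) (E := PreFock d c hc) x y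

theorem denseRange_toFock : DenseRange (toFock (d := d) hc) :=
  UniformSpace.Completion.denseRange_coe (α := PreFock d c hc)

theorem particle_eq_toFock (f : TestFn d) (n : ℕ) :
    particle hc f n = toFock hc (FockPoly.gen f ^ n) := by
  have h : (FockPoly.Bp f ^ n) 1 = FockPoly.gen f ^ n := by
    rw [FockPoly.Bp, LinearMap.pow_mulLeft, LinearMap.mulLeft_apply, mul_one]
  exact congrArg (toFock hc) h

theorem particle_smul (t : ℂ) (f : TestFn d) (n : ℕ) :
    particle hc (t • f) n = t ^ n • particle hc f n := by
  rw [particle_eq_toFock, particle_eq_toFock, map_smul, smul_pow, map_smul]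

theorem exists_norm_particle_le (f : TestFn d) :
    ∃ R : ℝ, 0 < R ∧ ∀ n : ℕ, ‖particle hc f n‖ ≤ n.factorial * R ^ n := by
  obtain ⟨m, hf⟩ := TestFn.exists_norm_ip_pw_le f
  set D := 2 * c * ‖TestFn.ip f f‖
  set R := 2 * c * ‖TestFn.ip f f‖ + 4 * m ^ 2
  have hD : 0 ≤ D := by positivity
  have hR : D ≤ R := le_add_of_nonneg_right (by positivity)
  refine ⟨R + 1, by linarith, fun n => ?_⟩
  refine abs_le_of_sq_le_sq' ?_ (by positivity) |>.2
  have hn : ‖particle hc f n‖ ^ 2 = ‖FockPoly.pair c (FockPoly.gen f ^ n) (FockPoly.gen f ^ n)‖ := by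
    rw [particle_eq_toFock, ← inner_toFock hc, inner_self_eq_norm_sq_to_K]
    simp
  rw [hn]
  cases n with
  | zero => simp [FockPoly.pair_one]
  | succ n =>
    have h := FockPoly.norm_pair_mixed_le hc.le f hf n 0
    rw [FockPoly.mixed, ← pow_succ', pow_zero, mul_one] at h
    refine h.trans ?_
    rw [mul_pow, mul_comm]
    gcongr
    calc D * R ^ n ≤ (R + 1) * (R + 1) ^ n := by gcongr <;> linarith
      _ = (R + 1) ^ (n + 1) := (pow_succ' _ _).symm
      _ ≤ ((R + 1) ^ (n + 1)) ^ 2 := le_self_pow₀ (one_le_pow₀ (by linarith)) two_ne_zero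

theorem eventually_expExists_smul (f : TestFn d) :
    ∀ᶠ t in nhds (0 : ℂ), ExpExists hc (t • f) := by
  obtain ⟨R, hR, hle⟩ := exists_norm_particle_le hc f
  filter_upwards [Metric.ball_mem_nhds (0 : ℂ) (inv_pos.2 hR)] with t ht
  have ht : ‖t‖ * R < 1 := by rwa [mem_ball_zero_iff, ← one_div, lt_div_iff₀ hR] at ht
  refine Summable.of_norm_bounded (summable_geometric_of_lt_one (by positivity) ht) fun n => ?_
  rw [particle_smul, norm_smul, norm_smul, norm_inv, Complex.norm_natCast, norm_pow, mul_pow,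
    inv_mul_le_iff₀ (by positivity), mul_left_comm]
  gcongr
  exact hle n

/-- A vector orthogonal to all exponential vectors is orthogonal to all `(B⁺_f)ⁿ Φ`: these are, up to
`n!`, the coefficients of the power series `t ↦ Ψ(t f)`. -/
theorem inner_particle_eq_zero {y : QuadraticFock d c hc} (hy : y ∈ (expSpan d hc)ᗮ)
    (f : TestFn d) (n : ℕ) : inner ℂ y (particle hc f n) = 0 := by
  have h : (fun n : ℕ => inner ℂ y ((n.factorial : ℂ)⁻¹ • particle hc f n)) = 0 := by
    refine eq_zero_of_eventually_hasSum_zero ?_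
    filter_upwards [eventually_expExists_smul hc f] with t ht
    have hs := (innerSL ℂ y).hasSum ht.hasSum
    have h0 : innerSL ℂ y (expVec hc (t • f)) = 0 :=
      (Submodule.mem_orthogonal' _ _).1 hy _ (expVec_mem hc ht)
    rw [expVec] at h0
    rw [h0] at hs
    have e : (fun n : ℕ => t ^ n * inner ℂ y ((n.factorial : ℂ)⁻¹ • particle hc f n)) =
        fun n : ℕ => innerSL ℂ y ((n.factorial : ℂ)⁻¹ • particle hc (t • f) n) := funext fun n => by
      simp only [innerSL_apply_apply, particle_smul, inner_smul_right]
      ring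
    rw [e]
    exact hs
  have hn := congrFun h n
  rw [inner_smul_right] at hn
  exact (mul_eq_zero.1 hn).resolve_left (inv_ne_zero (Nat.cast_ne_zero.2 n.factorial_ne_zero))

theorem dense_expSpan : Dense (expSpan d hc : Set (QuadraticFock d c hc)) := by
  rw [Submodule.dense_iff_topologicalClosure_eq_top, Submodule.topologicalClosure_eq_top_iff,
    Submodule.eq_bot_iff]
  intro y hy
  have h0 : (innerSL ℂ y).toLinearMap ∘ₗ toFock hc = 0 := by
    refine LinearMap.ext_on_range FockPoly.span_pow fun i => ?_
    have h := inner_particle_eq_zero hc hy i.1 i.2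
    rw [particle_eq_toFock] at h
    exact h
  refine Dense.eq_zero_of_inner_left (𝕜 := ℂ) (denseRange_toFock hc) ?_
  rintro _ ⟨x, rfl⟩
  exact congrArg (fun φ => φ x) h0

/-! ### Second quantization as an isometry -/

/-- An isometric endomorphism of the algebraic Fock space extends to the completion. -/
theorem exists_isometry_extension (M : FockPoly d →ₗ[ℂ] FockPoly d)
    (hM : ∀ y x, FockPoly.pair c (M y) (M x) = FockPoly.pair c y x) :
    ∃ V : QuadraticFock d c hc →ₗᵢ[ℂ] QuadraticFock d c hc,
      ∀ x, V (toFock hc x) = toFock hc (M x) := by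
  have hnorm : ∀ x : FockPoly d, ‖toFock hc (M x)‖ = ‖toFock hc x‖ := fun x => by
    rw [norm_eq_sqrt_re_inner (𝕜 := ℂ), norm_eq_sqrt_re_inner (𝕜 := ℂ), inner_toFock,
      inner_toFock, hM]
  have hb : ∃ C, ∀ x : FockPoly d, ‖(toFock hc ∘ₗ M) x‖ ≤ C * ‖toFock hc x‖ :=
    ⟨1, fun x => by rw [one_mul]; exact (hnorm x).le⟩
  have happ := LinearMap.extendOfNorm_eq (f := toFock hc ∘ₗ M) (denseRange_toFock hc) hb
  set V := (toFock hc ∘ₗ M).extendOfNorm (toFock hc)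
  refine ⟨⟨V.toLinearMap, fun x => ?_⟩, happ⟩
  refine (denseRange_toFock hc).induction_on x
    (isClosed_eq V.continuous.norm continuous_norm) fun x => ?_
  exact (congrArg norm (happ x)).trans (hnorm x)

/-- A linear isometry with `(B⁺_f)ⁿ Φ ↦ (B⁺_{T f})ⁿ Φ` restricts to the second quantization of `T`. -/
theorem isSecondQuantization_of_particle {T : TestFn d →ₗ[ℂ] TestFn d}
    (V : QuadraticFock d c hc →ₗᵢ[ℂ] QuadraticFock d c hc)
    (hV : ∀ f n, V (particle hc f n) = particle hc (T f) n) :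
    IsSecondQuantization hc T (V.toLinearMap ∘ₗ (expSpan d hc).subtype) := fun f hf => by
  have h : HasSum (fun n : ℕ => ((n.factorial : ℂ)⁻¹) • particle hc (T f) n)
      (V (expVec hc f)) := by
    have h := V.toContinuousLinearMap.hasSum hf.hasSum
    simp only [LinearIsometry.coe_toContinuousLinearMap, map_smul, hV] at h
    exact h
  exact ⟨h.summable, h.tsum_eq.symm⟩

theorem surjective_of_toFock_mem_range (V : QuadraticFock d c hc →ₗᵢ[ℂ] QuadraticFock d c hc)
    (h : ∀ x : FockPoly d, ∃ y, V y = toFock hc x) : Function.Surjective V := by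
  have hd : Dense (Set.range V) := (denseRange_toFock hc).mono (by rintro _ ⟨x, rfl⟩; exact h x)
  exact Set.range_eq_univ.1 (V.isometry.isClosedEmbedding.isClosed_range.closure_eq ▸ hd.closure_eq)

end QuadraticFock

theorem proposition1 (d : ℕ) (c : ℝ) (hc : 0 < c)
    (α : EuclideanSpace ℝ (Fin d) → ℝ) (hα : Measurable α)
    (T₁ : TestFn d →ₗ[ℂ] TestFn d) (hT₁ : IsStarEndomorphism T₁) :
    Dense (QuadraticFock.expSpan d hc : Set (QuadraticFock d c hc)) ∧
    ∃ G : QuadraticFock.expSpan d hc →ₗ[ℂ] QuadraticFock d c hc,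
      QuadraticFock.IsSecondQuantization hc (TestFn.phase α hα ∘ₗ T₁) G ∧
      (∃ V : QuadraticFock d c hc →ₗᵢ[ℂ] QuadraticFock d c hc,
        ∀ x : QuadraticFock.expSpan d hc, V x = G x) ∧
      (IsStarAutomorphism T₁ →
        ∃ U : QuadraticFock d c hc ≃ₗᵢ[ℂ] QuadraticFock d c hc,
          ∀ x : QuadraticFock.expSpan d hc, U x = G x) := by
  set T := TestFn.phase α hα ∘ₗ T₁ with hT
  have hmul : ∀ a f, T₁ a * T f = T (a * f) := fun a f => by
    rw [hT, LinearMap.comp_apply, LinearMap.comp_apply, TestFn.mul_phase, hT₁.map_mul]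
  have hstar : ∀ f g, star (T f) * T g = T₁ (star f * g) := fun f g => by
    rw [hT, LinearMap.comp_apply, LinearMap.comp_apply, TestFn.star_phase_mul_phase, hT₁.map_mul,
      hT₁.map_star]
  have hip : ∀ f g, TestFn.ip (T f) (T g) = TestFn.ip f g := fun f g => by
    rw [hT, LinearMap.comp_apply, LinearMap.comp_apply, TestFn.ip_phase, hT₁.isometry]
  obtain ⟨V, hV⟩ := QuadraticFock.exists_isometry_extension hc (FockPoly.map T).toLinearMap
    (FockPoly.pair_map c hmul hstar hip)
  have hVp : ∀ f n, V (QuadraticFock.particle hc f n) = QuadraticFock.particle hc (T f) n :=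
    fun f n => by
      rw [QuadraticFock.particle_eq_toFock, QuadraticFock.particle_eq_toFock, hV,
        AlgHom.toLinearMap_apply, map_pow, FockPoly.map_gen]
  refine ⟨QuadraticFock.dense_expSpan hc, _,
    QuadraticFock.isSecondQuantization_of_particle hc V hVp, ⟨V, fun _ => rfl⟩, fun hA => ?_⟩
  have hs : Function.Surjective (FockPoly.map T) :=
    FockPoly.map_surjective ((TestFn.phase_surjective α hα).comp hA.surjective)
  have hVs : Function.Surjective V := QuadraticFock.surjective_of_toFock_mem_range hc V fun x => by
    obtain ⟨y, rfl⟩ := hs x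
    exact ⟨_, hV y⟩
  exact ⟨LinearIsometryEquiv.ofSurjective V hVs, fun _ => rfl⟩
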